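/- Let $\mathcal A$ be a semi-abelian category: $\mathcal A$ is pointed, Barr exact, has binary coproducts and is Bourn protomodular (equivalently here, the regular Short Five Lemma holds). Call an object \emph{projective} if it lifts through all regular epimorphisms. A \emph{Birkhoff subcategory} $\mathcal B$ of $\mathcal A$ is a full reflective subcategory closed under subobjects and regular quotients; write $\eta_X\colon X\to I(X)$ for the unit of the reflection. An object $X$ is \emph{$\mathcal B$-perfect} if $I(X)=0$. An \emph{extension} is a regular epimorphism. An extension $f\colon B\to A$ is \emph{$\mathcal B$-trivial} if the naturality square $\eta_A\circ f=I(f)\circ \eta_B$ is a pullback, and \emph{$\mathcal B$-central} if its pullback along some extension $E\to A$ is $\mathcal B$-trivial. A \emph{universal $\mathcal B$-central extension} of $A$ is a $\mathcal B$-central extension $u\colon U\to A$ such that for every $\mathcal B$-central extension $f\colon B\to A$ there is a unique $h\colon U\to B$ with $f\circ h=u$. Let $\mathsf{Ab}(\mathcal A)$ be the Birkhoff subcategory of all objects of $\mathcal A$ that admit an internal abelian group structure. Suppose that $\mathcal A$ has enough projectives (every object is the codomain of a regular epimorphism with projective domain) and satisfies condition (UCE): whenever $B$ is an $\mathsf{Ab}(\mathcal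 A)$-perfect object and $f\colon B\to A$ and $g\colon C\to B$ are $\mathsf{Ab}(\mathcal A)$-central extensions, the composite $f\circ g$ is an $\mathsf{Ab}(\mathcal A)$-central extension. Let $\mathcal B$ be a Birkhoff subcategory of $\mathcal A$ that contains $\mathsf{Ab}(\mathcal A)$, and let $f\colon B\to A$ and $g\colon C\to B$ be $\mathcal B$-central extensions. Then $f\circ g\colon C\to A$ is a universal $\mathcal B$-central extension if and only if $g$ is a universal $\mathcal B$-central extension. -/

import Mathlib

open CategoryTheory Limits

universe v u

/-- A *semi-abelian* category: pointed, Barr exact (regular, and every internal equivalence relation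
is effective), Bourn protomodular (for a pointed regular category: the regular Short Five Lemma
holds), with binary coproducts. -/
class SemiAbelian (C : Type u) [Category.{v} C] [HasZeroMorphisms C] : Prop
    extends Regular C, HasZeroObject C, HasBinaryCoproducts C where
  /-- Barr exactness: every equivalence relation is effective. -/
  effective {R X : C} (p₁ p₂ : R ⟶ X) [IsEquivalenceRelation p₁ p₂] :
    IsEffectiveEquivalenceRelation p₁ p₂
  /-- Protomodularity: the regular Short Five Lemma. -/
  short_five {B' A' B A : C} (f' : B' ⟶ A') (f : B ⟶ A) [IsRegularEpi f'] [IsRegularEpi f]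
    (b : B' ⟶ B) (a : A' ⟶ A) (w : f' ≫ a = b ≫ f) [IsIso (kernel.map f' f b a w)] [IsIso a] :
    IsIso b

namespace SemiAbelian

variable {C : Type u} [Category.{v} C]

/-- `Q` is (regular) projective: it lifts through every regular epimorphism. -/
def IsRegularProjective (Q : C) : Prop :=
  ∀ ⦃E X : C⦄ (e : E ⟶ X) [IsRegularEpi e] (f : Q ⟶ X), ∃ f' : Q ⟶ E, f' ≫ e = f

variable (C) in
/-- Every object is a regular quotient of a (regular) projective object. -/
def HasEnoughRegularProjectives : Prop :=
  ∀ X : C, ∃ (Q : C) (p : Q ⟶ X), IsRegularProjective Q ∧ IsRegularEpi p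

/-- `P` is (the class of objects of) a *Birkhoff subcategory*: a full reflective subcategory
closed under subobjects and regular quotients. -/
structure IsBirkhoff (P : ObjectProperty C) : Prop where
  reflective : P.ι.IsRightAdjoint
  closedUnderSubobjects : P.IsClosedUnderSubobjects
  closedUnderRegularQuotients : ∀ ⦃X Y : C⦄ (f : X ⟶ Y) [IsRegularEpi f], P X → P Y

variable (C) in
/-- The class of *abelian objects*, i.e. objects that admit an internal abelian group structure
(with respect to the cartesian products of `C`). -/
def abelianObjects [HasFiniteProducts C] : ObjectProperty C := fun X =>
  letI : CartesianMonoidalCategory C := .ofHasFiniteProducts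
  letI : BraidedCategory C := .ofCartesianMonoidalCategory
  ∃ _ : GrpObj X, IsCommMonObj X

section

variable (P : ObjectProperty C)

/-- `η : X ⟶ Y` is a reflection of `X` in the full subcategory `P`, i.e. it has the universal
property of the component at `X` of the unit of the reflection. -/
structure IsReflection {X Y : C} (η : X ⟶ Y) : Prop where
  prop : P Y
  existsUnique : ∀ ⦃Z : C⦄, P Z → ∀ h : X ⟶ Z, ∃! k : Y ⟶ Z, η ≫ k = h

/-- `X` is `P`-*perfect*: its reflection is zero. -/
def IsPerfect (X : C) : Prop :=
  ∃ (Y : C) (η : X ⟶ Y), IsReflection P η ∧ IsZero Y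

/-- An extension (regular epimorphism) `f : X ⟶ Y` is `P`-*trivial* when the naturality square
```
  X  --f-->  Y
  |          |
  ηX         ηY
  v          v
 I(X) -If-> I(Y)
```
of the reflection is a pullback. -/
def IsTrivialExtension {X Y : C} (f : X ⟶ Y) : Prop :=
  IsRegularEpi f ∧ ∃ (IX IY : C) (ηX : X ⟶ IX) (ηY : Y ⟶ IY) (If : IX ⟶ IY),
    IsReflection P ηX ∧ IsReflection P ηY ∧ IsPullback f ηX ηY If

/-- An extension `f : X ⟶ Y` is `P`-*central* when its pullback along some extension
`g : Z ⟶ Y` is `P`-trivial. -/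
def IsCentralExtension [HasPullbacks C] {X Y : C} (f : X ⟶ Y) : Prop :=
  IsRegularEpi f ∧ ∃ (Z : C) (g : Z ⟶ Y), IsRegularEpi g ∧
    IsTrivialExtension P (pullback.snd f g)

/-- A *universal* `P`-central extension of `A`: an initial object among the `P`-central
extensions of `A`. -/
def IsUniversalCentralExtension [HasPullbacks C] {U A : C} (u : U ⟶ A) : Prop :=
  IsCentralExtension P u ∧
    ∀ ⦃B : C⦄ (f : B ⟶ A), IsCentralExtension P f → ∃! h : U ⟶ B, h ≫ f = u

end

variable (C) in
/-- The *universal central extension condition* (UCE). -/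
def ConditionUCE [HasFiniteLimits C] : Prop :=
  ∀ ⦃A B D : C⦄ (f : B ⟶ A) (g : D ⟶ B), IsPerfect (abelianObjects C) B →
    IsCentralExtension (abelianObjects C) f → IsCentralExtension (abelianObjects C) g →
      IsCentralExtension (abelianObjects C) (g ≫ f)

/-! Consistency with the reflector and its unit when a left adjoint of the inclusion is given. -/

section

variable {P : ObjectProperty C}

theorem isReflection_unit {L : C ⥤ P.FullSubcategory} (adj : L ⊣ P.ι) (X : C) :
    IsReflection P (adj.unit.app X) where
  prop := (L.obj X).property
  existsUnique Z hZ h := by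
    refine ⟨((adj.homEquiv X ⟨Z, hZ⟩).symm h).hom, ?_, fun k hk => ?_⟩
    · exact (adj.homEquiv_unit X ⟨Z, hZ⟩ _).symm.trans (Equiv.apply_symm_apply _ _)
    · have : (adj.homEquiv X ⟨Z, hZ⟩) ⟨k⟩ = h :=
        (adj.homEquiv_unit X ⟨Z, hZ⟩ _).trans hk
      rw [← this, Equiv.symm_apply_apply]

theorem IsReflection.exists_iso {X Y Y' : C} {η : X ⟶ Y} {η' : X ⟶ Y'}
    (h : IsReflection P η) (h' : IsReflection P η') : ∃ e : Y ≅ Y', η ≫ e.hom = η' := by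
  obtain ⟨a, ha, -⟩ := h.existsUnique h'.prop η'
  obtain ⟨b, hb, -⟩ := h'.existsUnique h.prop η
  exact ⟨⟨a, b, (h.existsUnique h.prop η).unique (by rw [reassoc_of% ha, hb])
    (by simp), (h'.existsUnique h'.prop η').unique (by rw [reassoc_of% hb, ha])
    (by simp)⟩, ha⟩

theorem isPerfect_iff {L : C ⥤ P.FullSubcategory} (adj : L ⊣ P.ι) (X : C) :
    IsPerfect P X ↔ IsZero (P.ι.obj (L.obj X)) := by
  refine ⟨fun ⟨Y, η, h, hY⟩ => ?_, fun h => ⟨_, _, isReflection_unit adj X, h⟩⟩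
  obtain ⟨e, -⟩ := (isReflection_unit adj X).exists_iso h
  exact hY.of_iso e

theorem isTrivialExtension_iff {L : C ⥤ P.FullSubcategory} (adj : L ⊣ P.ι) {X Y : C}
    (f : X ⟶ Y) : IsTrivialExtension P f ↔ IsRegularEpi f ∧
      IsPullback f (adj.unit.app X) (adj.unit.app Y) (P.ι.map (L.map f)) := by
  refine and_congr_right fun _ => ⟨?_, fun h => ⟨_, _, _, _, _, isReflection_unit adj X,
    isReflection_unit adj Y, h⟩⟩
  rintro ⟨IX, IY, ηX, ηY, If, hX, hY, h⟩
  obtain ⟨e, he⟩ := hX.exists_iso (isReflection_unit adj X)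
  obtain ⟨e', he'⟩ := hY.exists_iso (isReflection_unit adj Y)
  refine h.of_iso (Iso.refl _) (Iso.refl _) e e' (by simp) (by simpa using he)
    (by simpa using he') ?_
  refine (hX.existsUnique (L.obj Y).property (f ≫ adj.unit.app Y)).unique ?_ ?_
  · rw [← reassoc_of% h.w]
    exact congrArg (f ≫ ·) he'
  · rw [reassoc_of% he]
    exact (adj.unit.naturality f).symm

end

end SemiAbelian

/-! A map from a perfect object into a central extension is determined by its composite to the base
(`IsCentralExtension.hom_ext`), and the domain of a universal central extension is perfect. So in
both directions `D`, and with it its quotient `B`, is perfect, and only centrality and existence of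
factorizations remain. (UCE) concerns abelian objects only, but passes to `P` over perfect domains
(`ConditionUCE.comp`). If `f : B ⟶ A` is `P`-central with `B` perfect, its kernel pair is the
product of `B` and the kernel of `f`, and this makes that kernel an abelian object, so `f` is
already central for abelian objects. The converse implication always holds. If `g` is universal,
then `g ≫ f` is central, and a central extension of `A` is reached from `D` through its pullback
along `f`. If `g ≫ f` is universal, a central `e : E ⟶ B` is restricted to the kernel `K` of the
unit of `E`, which is perfect and still central over `B`. Then `K ⟶ B ⟶ A` is central and receives a
map from `D`, which lies over `B` because `f` is central and `D` perfect. -/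

namespace SemiAbelian

attribute [local simp] pullback.lift_fst pullback.lift_snd pullback.lift_fst_assoc
  pullback.lift_snd_assoc prod.lift_fst prod.lift_snd prod.lift_fst_assoc prod.lift_snd_assoc

/-! ### Regular epimorphisms and local lifting -/

section

variable {C : Type u} [Category.{v} C]

/-- A generalized element which locally factors through a monomorphism factors through it. -/
theorem exists_lift_of_local {T' T I Z : C} (c : T' ⟶ T) [IsRegularEpi c] (m : I ⟶ Z) [Mono m]
    (a : T' ⟶ I) (b : T ⟶ Z) (w : a ≫ m = c ≫ b) : ∃ l : T ⟶ I, l ≫ m = b :=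
  have sq : CommSq a c m b := ⟨w⟩
  ⟨sq.lift, sq.fac_right⟩

/-- A regular epimorphism is the coequalizer of its kernel pair. -/
theorem exists_desc_of_isRegularEpi {X Y Z : C} (e : X ⟶ Y) [IsRegularEpi e] (k : X ⟶ Z)
    (h : ∀ ⦃T : C⦄ (u v : T ⟶ X), u ≫ e = v ≫ e → u ≫ k = v ≫ k) : ∃ l : Y ⟶ Z, e ≫ l = k :=
  ⟨IsRegularEpi.desc e k (h _ _ (IsRegularEpi.w e)), IsRegularEpi.fac _ _ _⟩

end

section Regular

variable {C : Type u} [Category.{v} C] [Regular C]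

theorem isRegularEpi_comp {X Y Z : C} (f : X ⟶ Y) (g : Y ⟶ Z) [IsRegularEpi f]
    [IsRegularEpi g] : IsRegularEpi (f ≫ g) :=
  have := strongEpi_comp f g
  inferInstance

theorem isRegularEpi_of_comp {X Y Z : C} (f : X ⟶ Y) (g : Y ⟶ Z) [IsRegularEpi (f ≫ g)] :
    IsRegularEpi g :=
  have := strongEpi_of_strongEpi f g
  inferInstance

/-- A generalized element of the codomain of a regular epimorphism lifts to the domain after
passing to a cover. -/
theorem exists_local_lift {X Y T : C} (e : X ⟶ Y) [IsRegularEpi e] (t : T ⟶ Y) :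
    ∃ (T' : C) (c : T' ⟶ T) (x : T' ⟶ X), IsRegularEpi c ∧ x ≫ e = c ≫ t :=
  ⟨_, pullback.snd e t, pullback.fst e t, inferInstance, pullback.condition⟩

theorem exists_image {X Y : C} (f : X ⟶ Y) :
    ∃ (I : C) (e : X ⟶ I) (m : I ⟶ Y), IsRegularEpi e ∧ Mono m ∧ e ≫ m = f :=
  ⟨_, (Regular.strongEpiMonoFactorisation f).e, (Regular.strongEpiMonoFactorisation f).m,
    inferInstance, inferInstance, (Regular.strongEpiMonoFactorisation f).fac⟩

end Regular

/-! ### Consequences of the Short Five Lemma: permutability and quotients -/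

section

variable {C : Type u} [Category.{v} C] [HasZeroMorphisms C] [SemiAbelian C]

/-- A regular epimorphism with trivial kernel is an isomorphism. -/
theorem isIso_of_isRegularEpi {X Y : C} (f : X ⟶ Y) [IsRegularEpi f]
    (h : ∀ ⦃T : C⦄ (t : T ⟶ X), t ≫ f = 0 → t = 0) : IsIso f := by
  have h0 : kernel.ι f = 0 := h _ (kernel.condition f)
  have : IsIso (kernel.map f (𝟙 Y) f (𝟙 Y) rfl) := by
    refine ⟨0, ?_, ?_⟩
    · rw [← cancel_mono (kernel.ι f), h0]; simp
    · rw [← cancel_mono (kernel.ι (𝟙 Y))]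
      have : kernel.ι (𝟙 Y) = 0 := by simpa using kernel.condition (𝟙 Y)
      simp [this]
  exact short_five f (𝟙 Y) f (𝟙 Y) rfl

/-- A morphism into `N` that is onto a quotient of `N` and covers the corresponding kernel is a
regular epimorphism. -/
theorem isRegularEpi_of_kernel {M N Q T : C} (h : M ⟶ N) (q : N ⟶ Q) [IsRegularEpi (h ≫ q)]
    (c : T ⟶ kernel q) [IsRegularEpi c] (l : T ⟶ M) (w : l ≫ h = c ≫ kernel.ι q) :
    IsRegularEpi h := by
  obtain ⟨I, e, m, he, hm, rfl⟩ := exists_image h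
  have h1 : IsRegularEpi (e ≫ m ≫ q) := by rwa [← Category.assoc]
  have h2 : IsRegularEpi (m ≫ q) := isRegularEpi_of_comp e _
  have h3 : IsRegularEpi q := isRegularEpi_of_comp m _
  -- The image `m` and the identity of `N` have the same quotient `Q`. The map `k` induced on
  -- kernels is mono, and regular epi because it is hit by `c`, so the Short Five Lemma makes `m`
  -- invertible.
  let k := kernel.map (m ≫ q) q m (𝟙 Q) (by simp)
  have hk : k ≫ kernel.ι q = kernel.ι (m ≫ q) ≫ m := kernel.lift_ι _ _ _
  have : Mono k := by
    have : Mono (k ≫ kernel.ι q) := by rw [hk]; infer_instance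
    exact mono_of_mono k (kernel.ι q)
  obtain ⟨l', hl⟩ : ∃ l', l' ≫ k = c := ⟨kernel.lift (m ≫ q) (l ≫ e) (by simp [reassoc_of% w]), by
    rw [← cancel_mono (kernel.ι q)]
    simp [hk, ← w]⟩
  have hr : IsRegularEpi k := by
    have : IsRegularEpi (l' ≫ k) := by rwa [hl]
    exact isRegularEpi_of_comp l' k
  have : IsIso k := isIso_of_mono_of_strongEpi k
  have : IsIso m := short_five (m ≫ q) q m (𝟙 Q) _
  exact isRegularEpi_comp e m

/-- The two inclusions of the factors are jointly epimorphic on a product. -/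
theorem prod_hom_ext {X Y W Z : C} {p : W ⟶ X} {q : W ⟶ Y}
    (hW : ∀ ⦃T : C⦄ (x : T ⟶ W) (y : T ⟶ W), x ≫ p = y ≫ p → x ≫ q = y ≫ q → x = y)
    {i : X ⟶ W} {j : Y ⟶ W} (hip : i ≫ p = 𝟙 X) (hiq : i ≫ q = 0)
    (hjq : j ≫ q = 𝟙 Y) {a b : W ⟶ Z} (h1 : i ≫ a = i ≫ b) (h2 : j ≫ a = j ≫ b) : a = b := by
  -- The equalizer contains both axes: `j` splits `h ≫ q`, and the kernel of `q` lies on the axis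
  -- `i`. Hence `h` is epi.
  let h := equalizer.ι a b
  have : IsSplitEpi (h ≫ q) := ⟨⟨⟨equalizer.lift j h2, by simp [h, hjq]⟩⟩⟩
  have := isRegularEpi_of_kernel h q (𝟙 _) (kernel.ι q ≫ p ≫ equalizer.lift i h1) (by
    simp only [h, Category.assoc, equalizer.lift_ι, Category.id_comp]
    refine hW _ _ ?_ ?_
    · simp [hip]
    · simp [hiq])
  have hh : h ≫ a = h ≫ b := equalizer.condition a b
  exact (cancel_epi h).1 hh

/-- Permutability of the kernel pairs of two morphisms `f` and `e`. -/
theorem exists_permute {X Y Z : C} (f : X ⟶ Y) (e : X ⟶ Z) {T : C} (x x₁ x₂ : T ⟶ X)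
    (h1 : x ≫ f = x₁ ≫ f) (h2 : x₁ ≫ e = x₂ ≫ e) :
    ∃ (T' : C) (c : T' ⟶ T) (x₃ : T' ⟶ X), IsRegularEpi c ∧
      x₃ ≫ e = c ≫ x ≫ e ∧ x₃ ≫ f = c ≫ x₂ ≫ f := by
  -- triples
  let W := pullback (pullback.snd f f) (pullback.fst e e)
  let a : W ⟶ X := pullback.fst _ _ ≫ pullback.fst f f
  let a₁ : W ⟶ X := pullback.fst _ _ ≫ pullback.snd f f
  let q : W ⟶ pullback e e := pullback.snd _ _
  let a₂ : W ⟶ X := q ≫ pullback.snd e e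
  have ha1 : a₁ = q ≫ pullback.fst e e := pullback.condition
  have haf : a ≫ f = a₁ ≫ f := by
    simp only [a, a₁, Category.assoc]
    rw [pullback.condition (f := f) (g := f)]
  have ha2 : a₁ ≫ e = a₂ ≫ e := by
    rw [ha1]; simp only [a₂, Category.assoc, pullback.condition]
  have liftW : ∀ {T : C} (x x₁ x₂ : T ⟶ X), x ≫ f = x₁ ≫ f → x₁ ≫ e = x₂ ≫ e →
      ∃ w : T ⟶ W, w ≫ a = x ∧ w ≫ a₁ = x₁ ∧ w ≫ a₂ = x₂ ∧
        w ≫ q ≫ pullback.fst e e = x₁ := fun x x₁ x₂ h h' =>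
    ⟨pullback.lift (pullback.lift x x₁ h) (pullback.lift x₁ x₂ h') (by simp), by simp [a],
      by simp [a₁], by simp [a₂, q], by simp [q]⟩
  -- quadruples
  let V := pullback (prod.lift (a ≫ e) (a₂ ≫ f)) (prod.lift e f)
  let p : V ⟶ W := pullback.fst _ _
  have hV : p ≫ prod.lift (a ≫ e) (a₂ ≫ f) = pullback.snd _ _ ≫ prod.lift e f :=
    pullback.condition
  have hVe : p ≫ a ≫ e = (pullback.snd _ _ : V ⟶ X) ≫ e := by
    simpa using congrArg (· ≫ prod.fst) hV
  have hVf : p ≫ a₂ ≫ f = (pullback.snd _ _ : V ⟶ X) ≫ f := by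
    simpa using congrArg (· ≫ prod.snd) hV
  have liftV : ∀ {T : C} (w : T ⟶ W) (y : T ⟶ X), w ≫ a ≫ e = y ≫ e → w ≫ a₂ ≫ f = y ≫ f →
      ∃ v : T ⟶ V, v ≫ p = w := fun w y h h' =>
    ⟨pullback.lift w y (by ext <;> simp [h, h']), by simp [p]⟩
  -- A pair `(x₁, x₂)` extends to the quadruple with `x = x₁` and `x₃ = x₂`.
  have : IsSplitEpi (p ≫ q) := by
    obtain ⟨w, hw, hw1, hw2, hw3⟩ := liftW (pullback.fst e e) (pullback.fst e e)
      (pullback.snd e e) rfl pullback.condition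
    obtain ⟨v, hv⟩ := liftV w (pullback.snd e e) (by rw [reassoc_of% hw, pullback.condition])
      (by rw [reassoc_of% hw2])
    refine ⟨⟨⟨v, ?_⟩⟩⟩
    rw [reassoc_of% hv]
    refine pullback.hom_ext (by simpa using hw3) (by simpa [a₂] using hw2)
  have hk1 : kernel.ι q ≫ a₁ = 0 := by simp [ha1]
  have hk2 : kernel.ι q ≫ a₂ = 0 := by simp [a₂]
  have hkf : kernel.ι q ≫ a ≫ f = 0 := by rw [haf, reassoc_of% hk1, zero_comp]
  -- On the kernel of `q` both `x₁` and `x₂` vanish, so `x₃ = x` works.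
  obtain ⟨v, hv⟩ := liftV (kernel.ι q) (kernel.ι q ≫ a) (by simp)
    (by simp [hkf, reassoc_of% hk2])
  have : IsRegularEpi p := isRegularEpi_of_kernel p q (𝟙 _) v (by simp [hv])
  obtain ⟨w, hw, -, hw2, -⟩ := liftW x x₁ x₂ h1 h2
  obtain ⟨T', c, v, hc, hv⟩ := exists_local_lift p w
  refine ⟨T', c, v ≫ pullback.snd _ _, hc, ?_, ?_⟩
  · rw [Category.assoc, ← hVe, reassoc_of% hv, reassoc_of% hw]
  · rw [Category.assoc, ← hVf, reassoc_of% hv, reassoc_of% hw2]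

/-- The image along a regular epimorphism `f` of the kernel pair of a morphism `e` is the kernel
pair of a regular epimorphism. -/
theorem exists_quotient {X Y Z : C} (f : X ⟶ Y) [IsRegularEpi f] (e : X ⟶ Z) :
    ∃ (Q : C) (q : Y ⟶ Q), IsRegularEpi q ∧
      (∀ ⦃T : C⦄ (u v : T ⟶ X), u ≫ e = v ≫ e → u ≫ f ≫ q = v ≫ f ≫ q) ∧
      (∀ ⦃T : C⦄ (y₁ y₂ : T ⟶ Y), y₁ ≫ q = y₂ ≫ q →
        ∃ (T' : C) (c : T' ⟶ T) (u v : T' ⟶ X), IsRegularEpi c ∧ u ≫ e = v ≫ e ∧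
          u ≫ f = c ≫ y₁ ∧ v ≫ f = c ≫ y₂) := by
  obtain ⟨R, s, m, hs, hm, hsm⟩ :=
    exists_image (prod.lift (pullback.fst e e ≫ f) (pullback.snd e e ≫ f))
  let p₁ := m ≫ prod.fst
  let p₂ := m ≫ prod.snd
  have hs1 : s ≫ p₁ = pullback.fst e e ≫ f := by simp [p₁, reassoc_of% hsm]
  have hs2 : s ≫ p₂ = pullback.snd e e ≫ f := by simp [p₂, reassoc_of% hsm]
  have hext : ∀ ⦃T : C⦄ (a b : T ⟶ R), a ≫ p₁ = b ≫ p₁ → a ≫ p₂ = b ≫ p₂ → a = b := by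
    intro T a b h h'
    rw [← cancel_mono m]
    ext
    · simpa [p₁] using h
    · simpa [p₂] using h'
  have hlocal : ∀ ⦃T : C⦄ (t : T ⟶ R), ∃ (T' : C) (c : T' ⟶ T) (u v : T' ⟶ X),
      IsRegularEpi c ∧ u ≫ e = v ≫ e ∧ u ≫ f = c ≫ t ≫ p₁ ∧ v ≫ f = c ≫ t ≫ p₂ := by
    intro T t
    obtain ⟨T', c, x, hc, hx⟩ := exists_local_lift s t
    refine ⟨T', c, x ≫ pullback.fst e e, x ≫ pullback.snd e e, hc, ?_, ?_, ?_⟩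
    · simp [pullback.condition]
    · rw [Category.assoc, ← hs1, reassoc_of% hx]
    · rw [Category.assoc, ← hs2, reassoc_of% hx]
  have hlift : ∀ ⦃T T' : C⦄ (c : T' ⟶ T) (_ : IsRegularEpi c) (u v : T' ⟶ X) (y₁ y₂ : T ⟶ Y),
      u ≫ e = v ≫ e → u ≫ f = c ≫ y₁ → v ≫ f = c ≫ y₂ →
      ∃ t : T ⟶ R, t ≫ p₁ = y₁ ∧ t ≫ p₂ = y₂ := by
    intro T T' c hc u v y₁ y₂ h h1 h2
    obtain ⟨t, ht⟩ := exists_lift_of_local c m (pullback.lift u v h ≫ s) (prod.lift y₁ y₂) (by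
      rw [Category.assoc, hsm]
      ext
      · simp [h1]
      · simp [h2])
    exact ⟨t, by simp [p₁, reassoc_of% ht], by simp [p₂, reassoc_of% ht]⟩
  have hrel : IsEquivalenceRelation p₁ p₂ := by
    obtain ⟨r, hr1, hr2⟩ := hlift f inferInstance (𝟙 X) (𝟙 X) (𝟙 Y) (𝟙 Y) rfl (by simp) (by simp)
    obtain ⟨σ, hσ1, hσ2⟩ : ∃ σ : R ⟶ R, σ ≫ p₁ = p₂ ∧ σ ≫ p₂ = p₁ := by
      obtain ⟨T', c, u, v, hc, h, h1, h2⟩ := hlocal (𝟙 R)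
      exact hlift c hc v u _ _ h.symm (by simpa using h2) (by simpa using h1)
    obtain ⟨t, ht1, ht2⟩ : ∃ t : pullback p₂ p₁ ⟶ R, t ≫ p₁ = pullback.fst p₂ p₁ ≫ p₁ ∧
        t ≫ p₂ = pullback.snd p₂ p₁ ≫ p₂ := by
      obtain ⟨T₁, c, u, v, hc, h, h1, h2⟩ := hlocal (pullback.fst p₂ p₁)
      obtain ⟨T₂, d, u', v', hd, h', h1', h2'⟩ := hlocal (c ≫ pullback.snd p₂ p₁)
      -- The lifted pairs `(u, v)` and `(u', v')` need not be composable, since `v` and `u'` agree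
      -- only under `f`. Permuting replaces `u` by an `x` with the same image under `f` that is
      -- identified with `u'` by `e`.
      obtain ⟨T₃, k, x, hk, hx, hx'⟩ := exists_permute e f (d ≫ u) (d ≫ v) u' (by simp [h])
        (by simp [h1', h2, pullback.condition])
      have := isRegularEpi_comp k d
      have := isRegularEpi_comp (k ≫ d) c
      refine hlift ((k ≫ d) ≫ c) inferInstance x (k ≫ v') _ _ ?_ ?_ ?_
      · rw [hx', h']; simp
      · rw [hx]; simp [h1]
      · simp [h2']
    exact ⟨⟨{ right_cancellation := hext, r := r, reflexivity₁ := hr1, reflexivity₂ := hr2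
              s := σ, symmetry₁ := hσ1, symmetry₂ := hσ2
              c := _, isLimit := pullbackIsPullback p₂ p₁, t := t
              transitivity₁ := ht1, transitivity₂ := ht2 }⟩⟩
  obtain ⟨⟨E⟩⟩ := effective p₁ p₂
  refine ⟨E.B, E.π, inferInstance, fun T u v h => ?_, fun T y₁ y₂ h => ?_⟩
  · have h1 := E.isKernelPair.w
    have := congrArg (pullback.lift u v h ≫ s ≫ ·) h1
    simpa [reassoc_of% hs1, reassoc_of% hs2] using this
  · obtain ⟨T', c, u, v, hc, h', h1, h2⟩ := hlocal (E.isKernelPair.lift y₁ y₂ h)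
    exact ⟨T', c, u, v, hc, h', by simpa using h1, by simpa using h2⟩

end

/-! ### Reflections into a Birkhoff subcategory -/

section Birkhoff

variable {C : Type u} [Category.{v} C] {P : ObjectProperty C}

theorem IsBirkhoff.exists_isReflection (hP : IsBirkhoff P) (X : C) :
    ∃ (Y : C) (η : X ⟶ Y), IsReflection P η := by
  have := hP.reflective
  exact ⟨_, _, isReflection_unit (Adjunction.ofIsRightAdjoint P.ι) X⟩

theorem IsReflection.exists_map {X Y IX IY : C} {ηX : X ⟶ IX} {ηY : Y ⟶ IY}
    (hX : IsReflection P ηX) (hY : IsReflection P ηY) (f : X ⟶ Y) :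
    ∃ If : IX ⟶ IY, f ≫ ηY = ηX ≫ If := by
  obtain ⟨k, hk, -⟩ := hX.existsUnique hY.prop (f ≫ ηY)
  exact ⟨k, hk.symm⟩

theorem IsReflection.hom_ext {X IX Z : C} {η : X ⟶ IX} (h : IsReflection P η) (hZ : P Z)
    {a b : IX ⟶ Z} (w : η ≫ a = η ≫ b) : a = b :=
  (h.existsUnique hZ (η ≫ b)).unique w rfl

/-- The image of `η` lies in `P` by closure under subobjects, so the universal property splits its
inclusion. -/
theorem IsReflection.isRegularEpi [Regular C] (hP : IsBirkhoff P) {X IX : C} {η : X ⟶ IX}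
    (h : IsReflection P η) : IsRegularEpi η := by
  obtain ⟨I, e, m, he, hm, rfl⟩ := exists_image η
  have := hP.closedUnderSubobjects
  obtain ⟨k, hk, -⟩ := h.existsUnique (P.prop_of_mono m h.prop) e
  have hkm : k ≫ m = 𝟙 IX := h.hom_ext h.prop (by rw [← Category.assoc, hk, Category.comp_id])
  have : IsSplitEpi m := ⟨⟨⟨k, hkm⟩⟩⟩
  exact isRegularEpi_comp e m

/-- The naturality square of the reflection at a regular epimorphism is a regular pushout. -/
theorem IsBirkhoff.exists_local_lift [HasZeroMorphisms C] [SemiAbelian C] (hP : IsBirkhoff P)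
    {X Y IX IY : C} {ηX : X ⟶ IX} {ηY : Y ⟶ IY} (hX : IsReflection P ηX)
    (hY : IsReflection P ηY) (f : X ⟶ Y) [IsRegularEpi f] {If : IX ⟶ IY}
    (w : f ≫ ηY = ηX ≫ If) {T : C} (y : T ⟶ Y) (z : T ⟶ IX) (h : y ≫ ηY = z ≫ If) :
    ∃ (T' : C) (c : T' ⟶ T) (x : T' ⟶ X), IsRegularEpi c ∧ x ≫ f = c ≫ y ∧ x ≫ ηX = c ≫ z := by
  have := hX.isRegularEpi hP
  -- `Q` is a regular quotient of `IX`, so it lies in `P` and `q` factors through `ηY`. Thus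
  -- elements identified by `ηY` lift locally to elements identified by `ηX`.
  obtain ⟨Q, q, hq, hq1, hq2⟩ := exists_quotient f ηX
  have := isRegularEpi_comp f q
  obtain ⟨k, hk⟩ := exists_desc_of_isRegularEpi ηX (f ≫ q) hq1
  have : IsRegularEpi (ηX ≫ k) := by rwa [hk]
  have := isRegularEpi_of_comp ηX k
  obtain ⟨l, hl, -⟩ := hY.existsUnique (hP.closedUnderRegularQuotients k hX.prop) q
  obtain ⟨T₁, c, x, hc, hx⟩ := SemiAbelian.exists_local_lift ηX z
  obtain ⟨T₂, d, u, v, hd, huv, hu, hv⟩ := hq2 (x ≫ f) (c ≫ y) (by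
    rw [← hl, Category.assoc, reassoc_of% w, reassoc_of% hx, Category.assoc, reassoc_of% h])
  obtain ⟨T₃, a, x₃, ha, h1, h2⟩ := exists_permute f ηX (d ≫ x) u v (by simp [hu]) huv
  have := isRegularEpi_comp a d
  refine ⟨T₃, (a ≫ d) ≫ c, x₃, isRegularEpi_comp _ _, ?_, ?_⟩
  · simp [h2, hv]
  · simp [h1, hx]

end Birkhoff

/-! ### Perfect objects -/

section

variable {C : Type u} [Category.{v} C] [HasZeroMorphisms C] {P : ObjectProperty C}

theorem IsPerfect.eq_zero {X Z : C} (h : IsPerfect P X) (hZ : P Z) (k : X ⟶ Z) : k = 0 := by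
  obtain ⟨Y, η, hη, hY⟩ := h
  obtain ⟨l, rfl, -⟩ := hη.existsUnique hZ k
  rw [hY.eq_of_src l 0, comp_zero]

theorem IsReflection.isPerfect {X Y : C} {η : X ⟶ Y} (h : IsReflection P η) (h0 : η = 0) :
    IsPerfect P X :=
  ⟨Y, η, h, (IsZero.iff_id_eq_zero Y).2 (h.hom_ext h.prop (by simp [h0]))⟩

theorem IsPerfect.of_epi (hP : IsBirkhoff P) {X Y : C} (h : IsPerfect P X) (f : X ⟶ Y) [Epi f] :
    IsPerfect P Y := by
  obtain ⟨_, η, hη⟩ := hP.exists_isReflection Y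
  exact hη.isPerfect (by rw [← cancel_epi f, comp_zero]; exact h.eq_zero hη.prop _)

end

/-! ### Trivial extensions -/

section

variable {C : Type u} [Category.{v} C] {P : ObjectProperty C}

theorem IsTrivialExtension.exists_isPullback {X Y IX IY : C} {f : X ⟶ Y}
    (hf : IsTrivialExtension P f) {ηX : X ⟶ IX} {ηY : Y ⟶ IY} (hX : IsReflection P ηX)
    (hY : IsReflection P ηY) : ∃ If : IX ⟶ IY, IsPullback f ηX ηY If := by
  obtain ⟨-, IX', IY', ηX', ηY', If, hX', hY', h⟩ := hf
  obtain ⟨e, he⟩ := hX'.exists_iso hX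
  obtain ⟨e', he'⟩ := hY'.exists_iso hY
  exact ⟨e.inv ≫ If ≫ e'.hom, h.of_iso (Iso.refl _) (Iso.refl _) e e' (by simp) (by simpa using he)
    (by simpa using he') (by simp)⟩

theorem IsTrivialExtension.hom_ext (hP : IsBirkhoff P) {X Y IX T : C} {f : X ⟶ Y}
    (hf : IsTrivialExtension P f) {η : X ⟶ IX} (hη : IsReflection P η) {t t' : T ⟶ X}
    (h : t ≫ f = t' ≫ f) (h' : t ≫ η = t' ≫ η) : t = t' := by
  obtain ⟨_, ηY, hY⟩ := hP.exists_isReflection Y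
  obtain ⟨_, H⟩ := hf.exists_isPullback hη hY
  exact H.hom_ext h h'

end

section

variable {C : Type u} [Category.{v} C] [HasZeroMorphisms C] [SemiAbelian C]
  {P : ObjectProperty C}

/-- An extension is trivial as soon as its kernel meets the kernel of the reflection trivially. -/
theorem isTrivialExtension_of_kernel (hP : IsBirkhoff P) {X Y IX : C} (f : X ⟶ Y)
    [IsRegularEpi f] {η : X ⟶ IX} (hη : IsReflection P η)
    (H : ∀ ⦃T : C⦄ (t : T ⟶ X), t ≫ f = 0 → t ≫ η = 0 → t = 0) : IsTrivialExtension P f := by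
  obtain ⟨IY, ηY, hY⟩ := hP.exists_isReflection Y
  obtain ⟨If, w⟩ := hη.exists_map hY f
  -- The comparison with the pullback is always a regular epimorphism, so only its kernel matters.
  let h : X ⟶ pullback ηY If := pullback.lift f η w
  have h1 : h ≫ pullback.fst _ _ = f := by simp [h]
  have h2 : h ≫ pullback.snd _ _ = η := by simp [h]
  obtain ⟨T, c, x, hc, hx, hx'⟩ := hP.exists_local_lift hη hY f w (pullback.fst ηY If)
    (pullback.snd ηY If) pullback.condition
  have hxc : x ≫ h = c := by
    apply pullback.hom_ext
    · rw [Category.assoc, h1, hx]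
    · rw [Category.assoc, h2, hx']
  have : IsRegularEpi (x ≫ h) := by rwa [hxc]
  have := isRegularEpi_of_comp x h
  have : IsIso h := isIso_of_isRegularEpi h fun T t ht => H t
    (by rw [← h1, reassoc_of% ht, zero_comp]) (by rw [← h2, reassoc_of% ht, zero_comp])
  exact ⟨inferInstance, IX, IY, η, ηY, If, hη, hY,
    IsPullback.of_iso_pullback ⟨w⟩ (asIso h) h1 h2⟩

theorem isRegularEpi_of_isPullback {X' X Y' Y : C} {g' : X' ⟶ X} {f' : X' ⟶ Y'} {f : X ⟶ Y}
    {g : Y' ⟶ Y} (h : IsPullback g' f' f g) [IsRegularEpi f] : IsRegularEpi f' :=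
  Regular.regularEpiIsStableUnderBaseChange.of_isPullback h
    (inferInstanceAs (IsRegularEpi f))

theorem IsTrivialExtension.of_isPullback (hP : IsBirkhoff P) {X' X Y' Y : C} {g' : X' ⟶ X}
    {f' : X' ⟶ Y'} {f : X ⟶ Y} {g : Y' ⟶ Y} (h : IsPullback g' f' f g)
    (hf : IsTrivialExtension P f) : IsTrivialExtension P f' := by
  have := hf.1
  have := isRegularEpi_of_isPullback h
  obtain ⟨_, η, hη⟩ := hP.exists_isReflection X
  obtain ⟨_, η', hη'⟩ := hP.exists_isReflection X'
  obtain ⟨k, hk⟩ := hη'.exists_map hη g'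
  refine isTrivialExtension_of_kernel hP f' hη' fun T t ht ht' => h.hom_ext ?_ (by simp [ht])
  refine hf.hom_ext hP hη ?_ ?_
  · rw [Category.assoc, h.w, reassoc_of% ht]; simp
  · rw [Category.assoc, hk, reassoc_of% ht']; simp

theorem IsTrivialExtension.of_mono (hP : IsBirkhoff P) {X' X Y : C} {f : X ⟶ Y}
    (hf : IsTrivialExtension P f) (i : X' ⟶ X) [Mono i] [IsRegularEpi (i ≫ f)] :
    IsTrivialExtension P (i ≫ f) := by
  obtain ⟨_, η, hη⟩ := hP.exists_isReflection X
  obtain ⟨_, η', hη'⟩ := hP.exists_isReflection X'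
  obtain ⟨k, hk⟩ := hη'.exists_map hη i
  refine isTrivialExtension_of_kernel hP _ hη' fun T t ht ht' => ?_
  rw [← cancel_mono i]
  refine hf.hom_ext hP hη (by simpa using ht) ?_
  rw [Category.assoc, hk, reassoc_of% ht']; simp

/-- A split epimorphism whose pullback along an extension is trivial is itself trivial. -/
theorem IsTrivialExtension.of_split (hP : IsBirkhoff P) {W R V X : C} {a : W ⟶ R} {b : W ⟶ V}
    {p : R ⟶ X} {v : V ⟶ X} (h : IsPullback a b p v) [IsRegularEpi v]
    (hb : IsTrivialExtension P b) (s : X ⟶ R) (hs : s ≫ p = 𝟙 X) : IsTrivialExtension P p := by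
  have : IsSplitEpi p := ⟨⟨⟨s, hs⟩⟩⟩
  have : IsRegularEpi a := isRegularEpi_of_isPullback h.flip
  obtain ⟨_, ηR, hR⟩ := hP.exists_isReflection R
  obtain ⟨_, ηW, hW⟩ := hP.exists_isReflection W
  obtain ⟨_, ηV, hV⟩ := hP.exists_isReflection V
  obtain ⟨Ia, hIa⟩ := hW.exists_map hR a
  obtain ⟨Ib, hIb⟩ := hW.exists_map hV b
  refine isTrivialExtension_of_kernel hP p hR fun T t ht ht' => ?_
  let t' : T ⟶ W := h.lift t 0 (by simp [ht])
  have hta : t' ≫ a = t := h.lift_fst _ _ _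
  have htb : t' ≫ b = 0 := h.lift_snd _ _ _
  let σ : V ⟶ W := h.lift (v ≫ s) (𝟙 V) (by simp [hs])
  have hσa : σ ≫ a = v ≫ s := h.lift_fst _ _ _
  have hσb : σ ≫ b = 𝟙 V := h.lift_snd _ _ _
  obtain ⟨Iσ, hIσ⟩ := hV.exists_map hW σ
  -- Modulo `ηW`, `t'` is locally replaced by some `w` in the kernel of `a`. Such a `w` lies on the
  -- section `σ`, where vanishing under `ηV` forces vanishing under `ηW`.
  obtain ⟨T', c, w, hc, hwa, hw⟩ := hP.exists_local_lift hW hR a hIa (0 : T ⟶ R) (t' ≫ ηW)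
    (by rw [Category.assoc, ← hIa, reassoc_of% hta, ht', zero_comp])
  have hwσ : w = (w ≫ b) ≫ σ := by
    apply h.hom_ext
    · rw [Category.assoc, Category.assoc, hσa, ← reassoc_of% h.w, reassoc_of% hwa, hwa]
      simp
    · rw [Category.assoc, hσb, Category.comp_id]
  have hwV : (w ≫ b) ≫ ηV = 0 := by
    rw [Category.assoc, hIb, reassoc_of% hw, ← hIb, reassoc_of% htb]; simp
  have hwW : w ≫ ηW = 0 := by
    rw [hwσ, Category.assoc, hIσ, ← Category.assoc, hwV, zero_comp]
  have ht'W : t' ≫ ηW = 0 := by rw [← cancel_epi c, ← hw, hwW, comp_zero]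
  have : t' = 0 := hb.hom_ext hP hW (by simp [htb]) (by simp [ht'W])
  rw [← hta, this, zero_comp]

/-! ### Central extensions -/

/-- Central extensions are normal: their kernel pair projections are trivial. -/
theorem IsCentralExtension.isTrivialExtension_snd (hP : IsBirkhoff P) {X Y : C} {f : X ⟶ Y}
    (hf : IsCentralExtension P f) : IsTrivialExtension P (pullback.snd f f) := by
  obtain ⟨hf, Z, g, hg, ht⟩ := hf
  have h := IsPullback.of_hasPullback (pullback.snd f f) (pullback.fst f g)
  refine IsTrivialExtension.of_split hP h ?_ (pullback.lift (𝟙 X) (𝟙 X) rfl) (by simp)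
  -- The pasted square lies over `pullback.fst f g ≫ f = pullback.snd f g ≫ g`, so it is also a base
  -- change of the trivial extension `pullback.snd f g`.
  have h1 := h.paste_horiz (IsPullback.of_hasPullback f f)
  rw [pullback.condition (f := f) (g := g)] at h1
  obtain ⟨x, hx1, hx2⟩ : ∃ x : _ ⟶ pullback f g, x ≫ pullback.fst f g = _ ∧
      x ≫ pullback.snd f g = _ :=
    ⟨pullback.lift _ (pullback.snd _ _ ≫ pullback.snd f g) (h1.w.trans (Category.assoc _ _ _).symm), pullback.lift_fst _ _ _,
      pullback.lift_snd _ _ _⟩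
  rw [← hx1] at h1
  exact ht.of_isPullback hP (IsPullback.of_right h1 hx2 (IsPullback.of_hasPullback f g))

/-- The pullback of a central extension `f` along a morphism factoring through `f` is trivial. -/
theorem IsCentralExtension.isTrivialExtension_of_isPullback (hP : IsBirkhoff P) {W Z X Y : C}
    {f : X ⟶ Y} (hf : IsCentralExtension P f) {s : W ⟶ X} {r : W ⟶ Z} {a : Z ⟶ X}
    (h : IsPullback s r f (a ≫ f)) : IsTrivialExtension P r :=
  IsTrivialExtension.of_isPullback hP (IsPullback.of_right
    (h₁₁ := pullback.lift s (r ≫ a) (by simpa using h.w))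
    (by simpa using h) (by simp) (IsPullback.of_hasPullback f f)) (hf.isTrivialExtension_snd hP)

theorem IsCentralExtension.of_isPullback (hP : IsBirkhoff P) {X' X Y' Y : C} {g' : X' ⟶ X}
    {f' : X' ⟶ Y'} {f : X ⟶ Y} {g : Y' ⟶ Y} (h : IsPullback g' f' f g)
    (hf : IsCentralExtension P f) : IsCentralExtension P f' := by
  have := hf.1
  have := isRegularEpi_of_isPullback h
  have h1 := (IsPullback.of_hasPullback f' f').paste_horiz h
  rw [← h.w] at h1
  exact ⟨inferInstance, X', f', inferInstance, hf.isTrivialExtension_of_isPullback hP h1⟩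

/-- The pullback is a subobject of the kernel pair of `f`, whose projection is trivial. -/
theorem IsCentralExtension.isTrivialExtension_snd_of_mono (hP : IsBirkhoff P) {X' X Y : C}
    {f : X ⟶ Y} (hf : IsCentralExtension P f) (i : X' ⟶ X) [Mono i] [IsRegularEpi (i ≫ f)] :
    IsTrivialExtension P (pullback.snd (i ≫ f) f) := by
  let m : pullback (i ≫ f) f ⟶ pullback f f :=
    pullback.lift (pullback.fst _ _ ≫ i) (pullback.snd _ _) (by simp [pullback.condition])
  have hm1 : m ≫ pullback.fst _ _ = pullback.fst _ _ ≫ i := by simp [m]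
  have hm2 : m ≫ pullback.snd _ _ = pullback.snd _ _ := by simp [m]
  have : Mono m := ⟨fun a b h => by
    apply pullback.hom_ext
    · rw [← cancel_mono i, Category.assoc, Category.assoc, ← hm1, reassoc_of% h]
    · rw [← hm2, reassoc_of% h]⟩
  have : IsRegularEpi (m ≫ pullback.snd f f) := by rw [hm2]; infer_instance
  rw [← hm2]
  exact (hf.isTrivialExtension_snd hP).of_mono hP m

theorem IsCentralExtension.of_mono (hP : IsBirkhoff P) {X' X Y : C} {f : X ⟶ Y}
    (hf : IsCentralExtension P f) (i : X' ⟶ X) [Mono i] [IsRegularEpi (i ≫ f)] :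
    IsCentralExtension P (i ≫ f) :=
  ⟨inferInstance, X, f, hf.1, hf.isTrivialExtension_snd_of_mono hP i⟩

/-- Trivial extensions are central. -/
theorem IsTrivialExtension.isCentralExtension (hP : IsBirkhoff P) {X Y : C} {f : X ⟶ Y}
    (hf : IsTrivialExtension P f) : IsCentralExtension P f :=
  ⟨hf.1, Y, 𝟙 Y, inferInstance, hf.of_isPullback hP (IsPullback.of_hasPullback f (𝟙 Y))⟩

/-- Morphisms from a perfect object to a central extension over the base are unique. -/
theorem IsCentralExtension.hom_ext (hP : IsBirkhoff P) {X Y U : C} {f : X ⟶ Y}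
    (hf : IsCentralExtension P f) (hU : IsPerfect P U) {h k : U ⟶ X} (w : h ≫ f = k ≫ f) :
    h = k := by
  obtain ⟨_, η, hη⟩ := hP.exists_isReflection (pullback f f)
  have : pullback.lift h k w = pullback.lift k k rfl :=
    (hf.isTrivialExtension_snd hP).hom_ext hP hη (by simp)
      ((hU.eq_zero hη.prop _).trans (hU.eq_zero hη.prop _).symm)
  simpa using congrArg (· ≫ pullback.fst f f) this

/-- A central extension of a perfect object restricts to a central extension with perfect
domain. -/
theorem IsCentralExtension.exists_perfect (hP : IsBirkhoff P) {E B : C} {e : E ⟶ B}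
    (he : IsCentralExtension P e) (hB : IsPerfect P B) :
    ∃ (K : C) (i : K ⟶ E), IsPerfect P K ∧ IsCentralExtension P (i ≫ e) := by
  have := he.1
  obtain ⟨_, η, hη⟩ := hP.exists_isReflection E
  obtain ⟨_, ηB, hηB⟩ := hP.exists_isReflection B
  obtain ⟨Ie, hIe⟩ := hη.exists_map hηB e
  let i := kernel.ι η
  have hi : i ≫ η = 0 := kernel.condition η
  have : IsRegularEpi (i ≫ e) := by
    obtain ⟨T, c, x, hc, hx, hx'⟩ := hP.exists_local_lift hη hηB e hIe (𝟙 B) 0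
      ((hB.eq_zero hηB.prop _).trans zero_comp.symm)
    rw [comp_zero] at hx'
    have hc' : kernel.lift η x hx' ≫ i ≫ e = c := by simpa [i] using hx
    have : IsRegularEpi (kernel.lift η x hx' ≫ i ≫ e) := by rwa [hc']
    exact isRegularEpi_of_comp (kernel.lift η x hx') _
  refine ⟨_, i, ?_, he.of_mono hP i⟩
  have h1 : IsTrivialExtension P (pullback.fst (i ≫ e) e) :=
    he.isTrivialExtension_of_isPullback hP (IsPullback.of_hasPullback (i ≫ e) e).flip
  have h2 := he.isTrivialExtension_snd_of_mono hP i
  obtain ⟨_, ηS, hS⟩ := hP.exists_isReflection (pullback (i ≫ e) e)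
  obtain ⟨_, ηK, hK⟩ := hP.exists_isReflection (kernel η)
  obtain ⟨q, hq⟩ := hS.exists_map hK (pullback.fst (i ≫ e) e)
  obtain ⟨_, hpb⟩ := h2.exists_isPullback hS hη
  -- `s` lifts `i` into the kernel of `ηS`. Triviality of the first projection forces `s` to agree
  -- with the diagonal `δ` along its first component, which is therefore the identity; since `ηK`
  -- kills that component, `ηK = 0`.
  let s := hpb.lift i 0 (by simp [hi])
  have hs2 : s ≫ pullback.snd _ _ = i := hpb.lift_fst _ _ _
  have hsη : s ≫ ηS = 0 := hpb.lift_snd _ _ _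
  let δ : kernel η ⟶ pullback (i ≫ e) e := pullback.lift (𝟙 _) i (by simp)
  have hδ1 : δ ≫ pullback.fst _ _ = 𝟙 _ := by simp [δ]
  have hδ2 : δ ≫ pullback.snd _ _ = i := by simp [δ]
  obtain ⟨Iδ, hIδ⟩ := hK.exists_map hS δ
  have ha : (s ≫ pullback.fst _ _) ≫ ηK = 0 := by
    rw [Category.assoc, hq, reassoc_of% hsη, zero_comp]
  have hsδ : (s ≫ pullback.fst _ _) ≫ δ = s :=
    h1.hom_ext hP hS (by rw [Category.assoc, hδ1, Category.comp_id])
      (by rw [Category.assoc, hIδ, ← Category.assoc, ha, zero_comp, hsη])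
  have hid : s ≫ pullback.fst _ _ = 𝟙 _ := by
    rw [← cancel_mono i, Category.id_comp]
    conv_rhs => rw [← hs2, ← hsδ, Category.assoc, hδ2]
  rw [hid, Category.id_comp] at ha
  exact hK.isPerfect ha

/-- The domain of a universal central extension is perfect. -/
theorem IsUniversalCentralExtension.isPerfect (hP : IsBirkhoff P) {U A : C} {u : U ⟶ A}
    (hu : IsUniversalCentralExtension P u) : IsPerfect P U := by
  obtain ⟨I, η, hη⟩ := hP.exists_isReflection U
  -- The test extension is the projection from `A ⨯ I`: both `(u, η)` and `(u, 0)` lift `u`, so `η =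
  -- 0`.
  have : IsSplitEpi (prod.fst : A ⨯ I ⟶ A) := ⟨⟨⟨prod.lift (𝟙 A) 0, by simp [prod.lift_fst]⟩⟩⟩
  have hc : IsCentralExtension P (prod.fst : A ⨯ I ⟶ A) := by
    obtain ⟨_, ηA, hηA⟩ := hP.exists_isReflection (A ⨯ I)
    obtain ⟨k, hk, -⟩ := hηA.existsUnique hη.prop prod.snd
    refine (isTrivialExtension_of_kernel hP _ hηA fun T t ht ht' => ?_).isCentralExtension hP
    ext
    · simpa using ht
    · rw [← hk, reassoc_of% ht']; simp
  have := (hu.2 _ hc).unique (y₁ := prod.lift u η) (y₂ := prod.lift u 0) (by simp [prod.lift_fst])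
    (by simp [prod.lift_fst])
  exact hη.isPerfect (by simpa [prod.lift_snd] using congrArg (· ≫ prod.snd) this)

end

section

variable {C : Type u} [Category.{v} C] {P : ObjectProperty C}

theorem IsReflection.of_le {P' : ObjectProperty C} (h : P' ≤ P) {X Y : C} {η : X ⟶ Y}
    (hη : IsReflection P η) (hY : P' Y) : IsReflection P' η :=
  ⟨hY, fun _ hZ => hη.existsUnique (h _ hZ)⟩

end

/-! ### Abelian objects and the transfer of (UCE) -/

section

variable {C : Type u} [Category.{v} C] [HasZeroMorphisms C] [SemiAbelian C]

open MonoidalCategory CartesianMonoidalCategory in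
/-- A unital magma in a semi-abelian category is an internal abelian group. -/
theorem exists_grpObj_of_mul [CartesianMonoidalCategory C] [BraidedCategory C] {N : C}
    (m : N ⊗ N ⟶ N) (h1 : lift (𝟙 N) 0 ≫ m = 𝟙 N) (h2 : lift 0 (𝟙 N) ≫ m = 𝟙 N) :
    ∃ _ : GrpObj N, IsCommMonObj N := by
  have hl : ∀ {T : C} (x : T ⟶ N), lift x 0 ≫ m = x := fun {T} x => by
    have : lift x (0 : T ⟶ N) = x ≫ lift (𝟙 N) 0 := by ext <;> simp
    rw [this, Category.assoc, h1, Category.comp_id]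
  have hr : ∀ {T : C} (x : T ⟶ N), lift 0 x ≫ m = x := fun {T} x => by
    have : lift (0 : T ⟶ N) x = x ≫ lift 0 (𝟙 N) := by ext <;> simp
    rw [this, Category.assoc, h2, Category.comp_id]
  -- Commutativity and associativity need only be checked on the axes of a product.
  have hext : ∀ {X Y Z : C} {a b : X ⊗ Y ⟶ Z}, lift (𝟙 X) 0 ≫ a = lift (𝟙 X) 0 ≫ b →
      lift 0 (𝟙 Y) ≫ a = lift 0 (𝟙 Y) ≫ b → a = b := fun {X Y Z a b} h h' =>
    prod_hom_ext (p := fst X Y) (q := snd X Y) (fun T x y => CartesianMonoidalCategory.hom_ext x y)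
      (lift_fst _ _) (lift_snd _ _) (lift_snd _ _) h h'
  have hcomm : (β_ N N).hom ≫ m = m := by
    apply hext
    · have : lift (𝟙 N) 0 ≫ (β_ N N).hom = lift 0 (𝟙 N) := by ext <;> simp
      rw [reassoc_of% this, h1, h2]
    · have : lift 0 (𝟙 N) ≫ (β_ N N).hom = lift (𝟙 N) 0 := by ext <;> simp
      rw [reassoc_of% this, h1, h2]
  have hassoc : (m ▷ N) ≫ m = (α_ N N N).hom ≫ (N ◁ m) ≫ m := by
    apply hext
    · have e1 : lift (𝟙 (N ⊗ N)) 0 ≫ m ▷ N = lift m 0 := by ext <;> simp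
      have e2 : lift (𝟙 (N ⊗ N)) 0 ≫ (α_ N N N).hom ≫ N ◁ m = 𝟙 _ := by
        ext
        · simp
        · have : lift (𝟙 (N ⊗ N)) 0 ≫ (α_ N N N).hom ≫ snd _ _ = lift (snd N N) 0 := by
            ext <;> simp
          simp only [Category.assoc, whiskerLeft_snd, reassoc_of% this, hl, Category.id_comp]
      have e3 := e2 =≫ m
      simp only [Category.assoc, Category.id_comp] at e3
      rw [reassoc_of% e1, hl, e3]
    · have e1 : lift 0 (𝟙 N) ≫ m ▷ N = lift 0 (𝟙 N) := by ext <;> simp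
      have e2 : lift (0 : N ⟶ N ⊗ N) (𝟙 N) ≫ (α_ N N N).hom ≫ N ◁ m = lift 0 (𝟙 N) := by
        ext
        · simp
        · have : lift (0 : N ⟶ N ⊗ N) (𝟙 N) ≫ (α_ N N N).hom ≫ snd _ _ = lift 0 (𝟙 N) := by
            ext <;> simp
          simp only [Category.assoc, whiskerLeft_snd, reassoc_of% this, h2, lift_snd]
      have e3 := e2 =≫ m
      simp only [Category.assoc] at e3
      rw [reassoc_of% e1, e3]
  -- the shear map
  let s : N ⊗ N ⟶ N ⊗ N := lift (fst N N) m
  have hs1 : s ≫ fst N N = fst N N := lift_fst _ _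
  have hs2 : s ≫ snd N N = m := lift_snd _ _
  have hzero : ∀ {T : C} (t : T ⟶ N ⊗ N), t ≫ fst N N = 0 → t ≫ m = t ≫ snd N N := by
    intro T t ht
    have : t = lift 0 (t ≫ snd N N) := by ext <;> simp [ht]
    conv_lhs => rw [this]
    exact hr _
  have : IsSplitEpi (s ≫ fst N N) := ⟨⟨⟨lift (𝟙 N) 0, by simp [hs1]⟩⟩⟩
  have : IsRegularEpi s := isRegularEpi_of_kernel s (fst N N) (𝟙 _) (kernel.ι _) (by
    ext
    · simp [hs1]
    · simp only [Category.assoc, hs2, Category.id_comp]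
      exact hzero _ (kernel.condition _))
  have : IsIso s := isIso_of_isRegularEpi s fun T t ht => by
    have h0 : t ≫ fst N N = 0 := by rw [← hs1, reassoc_of% ht, zero_comp]
    ext
    · simp [h0]
    · rw [← hzero t h0, ← hs2, reassoc_of% ht]
  have hi1 : CategoryTheory.inv s ≫ fst N N = fst N N := by rw [IsIso.inv_comp_eq, hs1]
  have hi2 : CategoryTheory.inv s ≫ m = snd N N := by rw [IsIso.inv_comp_eq, hs2]
  let ν : N ⟶ N := lift (𝟙 N) 0 ≫ CategoryTheory.inv s ≫ snd N N
  have hν : lift (𝟙 N) ν ≫ m = 0 := by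
    have : lift (𝟙 N) ν = lift (𝟙 N) 0 ≫ CategoryTheory.inv s := by
      ext <;> simp [hi1, ν]
    rw [this, Category.assoc, hi2, lift_snd]
  have hν' : lift ν (𝟙 N) ≫ m = 0 := by
    have : lift ν (𝟙 N) = lift (𝟙 N) ν ≫ (β_ N N).hom := by ext <;> simp
    rw [this, Category.assoc, hcomm, hν]
  let M : MonObj N :=
    { one := 0
      mul := m
      one_mul := by
        have : (0 : 𝟙_ C ⟶ N) ▷ N = lift 0 (snd _ _) := by ext <;> simp
        rw [this, hr, leftUnitor_hom]
      mul_one := by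
        have : N ◁ (0 : 𝟙_ C ⟶ N) = lift (fst _ _) 0 := by ext <;> simp
        rw [this, hl, rightUnitor_hom]
      mul_assoc := hassoc }
  exact ⟨{ M with
    inv := ν
    left_inv := hν'.trans comp_zero.symm
    right_inv := hν.trans comp_zero.symm }, ⟨hcomm⟩⟩

theorem abelianObjects_of_mul {N : C} (m : N ⨯ N ⟶ N) (h1 : prod.lift (𝟙 N) 0 ≫ m = 𝟙 N)
    (h2 : prod.lift 0 (𝟙 N) ≫ m = 𝟙 N) : abelianObjects C N := by
  let : CartesianMonoidalCategory C := .ofHasFiniteProducts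
  let : BraidedCategory C := .ofCartesianMonoidalCategory
  refine exists_grpObj_of_mul (prod.lift (SemiCartesianMonoidalCategory.fst N N)
    (SemiCartesianMonoidalCategory.snd N N) ≫ m) ?_ ?_
  · refine Eq.trans ?_ h1
    rw [← Category.assoc]
    congr 1
    ext <;> simp
  · refine Eq.trans ?_ h2
    rw [← Category.assoc]
    congr 1
    ext <;> simp

theorem abelianObjects_of_isZero {Z : C} (hZ : IsZero Z) : abelianObjects C Z :=
  abelianObjects_of_mul 0 (hZ.eq_of_src _ _) (hZ.eq_of_src _ _)

variable {P : ObjectProperty C}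

theorem IsPerfect.abelianObjects (hAb : abelianObjects C ≤ P) {X : C} (h : IsPerfect P X) :
    IsPerfect (abelianObjects C) X := by
  obtain ⟨Y, η, hη, hY⟩ := h
  exact ⟨Y, η, hη.of_le hAb (abelianObjects_of_isZero hY), hY⟩

/-- A central extension with perfect domain is central with respect to the abelian objects. -/
theorem IsCentralExtension.abelianObjects_of_isPerfect (hP : IsBirkhoff P)
    (hAb : abelianObjects C ≤ P) {B A : C} {f : B ⟶ A} (hf : IsCentralExtension P f)
    (hB : IsPerfect P B) : IsCentralExtension (abelianObjects C) f := by
  have := hf.1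
  obtain ⟨Z, ηB, hηB, hZ⟩ := id hB
  obtain ⟨N, η, hη⟩ := hP.exists_isReflection (pullback f f)
  obtain ⟨If, hpb⟩ := (hf.isTrivialExtension_snd hP).exists_isPullback hη hηB
  -- As the reflection of `B` is zero, `(pullback.snd f f, η)` exhibits the kernel pair as `B ⨯ N`.
  -- Then `κ` embeds `N` as the kernel of `f`.
  obtain ⟨k, hk1, hk2⟩ : ∃ k : N ⟶ pullback f f, k ≫ pullback.snd f f = 0 ∧ k ≫ η = 𝟙 N :=
    ⟨hpb.lift 0 (𝟙 N) (hZ.eq_of_tgt _ _), hpb.lift_fst _ _ _, hpb.lift_snd _ _ _⟩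
  let κ : N ⟶ B := k ≫ pullback.fst f f
  have hκ : κ ≫ f = 0 := by
    rw [Category.assoc, pullback.condition, reassoc_of% hk1, zero_comp]
  obtain ⟨r, hr1, hr2⟩ : ∃ r : N ⨯ N ⟶ pullback f f,
      r ≫ pullback.snd f f = prod.fst ≫ κ ∧ r ≫ η = prod.snd :=
    ⟨hpb.lift (prod.fst ≫ κ) prod.snd (hZ.eq_of_tgt _ _), hpb.lift_fst _ _ _, hpb.lift_snd _ _ _⟩
  have hr : (r ≫ pullback.fst f f) ≫ f = 0 := by
    rw [Category.assoc, pullback.condition, reassoc_of% hr1, hκ, comp_zero]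
  have hκk : ∀ {T : C} (t : T ⟶ N) (x : T ⟶ pullback f f), x ≫ pullback.fst f f = t ≫ κ →
      x ≫ pullback.snd f f = 0 → x = t ≫ k := fun t x h h' =>
    pullback.hom_ext (by rw [h, Category.assoc]) (by rw [h', Category.assoc, hk1, comp_zero])
  -- The product of `(a, b)` is the first component of the pair with second component `κ a` and
  -- class `b`. For `b = 0` that pair is diagonal, as `η` kills the diagonal of the perfect `B`; for
  -- `a = 0` it is `k b`. So `0` is a two-sided unit.
  let m : N ⨯ N ⟶ N := pullback.lift (r ≫ pullback.fst f f) 0 (by rw [hr, zero_comp]) ≫ η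
  have hm : ∀ t : N ⟶ N ⨯ N, t ≫ r ≫ pullback.fst f f = κ → t ≫ m = 𝟙 N := by
    intro t ht
    have := hκk (𝟙 N) (t ≫ pullback.lift (r ≫ pullback.fst f f) 0 (by rw [hr, zero_comp]))
      (by simpa using ht) (by simp)
    rw [← Category.assoc, this, Category.id_comp, hk2]
  have hN : abelianObjects C N := by
    refine abelianObjects_of_mul m (hm _ ?_) (hm _ ?_)
    · have : prod.lift (𝟙 N) 0 ≫ r = κ ≫ pullback.lift (𝟙 B) (𝟙 B) rfl := by
        apply hpb.hom_ext
        · simp [hr1]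
        · rw [Category.assoc, hr2, Category.assoc, hB.eq_zero hη.prop (_ ≫ η)]
          simp
      rw [reassoc_of% this]
      simp
    · have : prod.lift 0 (𝟙 N) ≫ r = k := by
        apply hpb.hom_ext
        · simp [hr1, hk1]
        · simp [hr2, hk2]
      rw [reassoc_of% this]
  exact ⟨inferInstance, B, f, inferInstance, inferInstance, N, Z, η, ηB, If, hη.of_le hAb hN,
    hηB.of_le hAb (abelianObjects_of_isZero hZ), hpb⟩

/-- Centrality with respect to a smaller class implies centrality with respect to a Birkhoff
subcategory. -/
theorem IsCentralExtension.of_le (hP : IsBirkhoff P) {P' : ObjectProperty C} (h : P' ≤ P)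
    {B A : C} {f : B ⟶ A} (hf : IsCentralExtension P' f) : IsCentralExtension P f := by
  obtain ⟨hf, Z, g, hg, -, IX, IY, ηX, ηY, If, hX, hY, hpb⟩ := hf
  obtain ⟨_, η, hη⟩ := hP.exists_isReflection (pullback f g)
  -- The reflection in the smaller class factors through `η`, so `η` has the smaller kernel.
  obtain ⟨k, rfl, -⟩ := hη.existsUnique (h _ hX.prop) ηX
  exact ⟨hf, Z, g, hg, isTrivialExtension_of_kernel hP _ hη fun T t ht ht' =>
    hpb.hom_ext (by rw [ht, zero_comp]) (by rw [reassoc_of% ht']; simp)⟩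

/-- Under (UCE), central extensions compose when the domains are perfect. -/
theorem ConditionUCE.comp (huce : ConditionUCE C) (hP : IsBirkhoff P)
    (hAb : abelianObjects C ≤ P) {A B D : C} {f : B ⟶ A} {g : D ⟶ B}
    (hf : IsCentralExtension P f) (hg : IsCentralExtension P g) (hB : IsPerfect P B)
    (hD : IsPerfect P D) : IsCentralExtension P (g ≫ f) :=
  (huce f g (hB.abelianObjects hAb) (hf.abelianObjects_of_isPerfect hP hAb hB)
    (hg.abelianObjects_of_isPerfect hP hAb hD)).of_le hP hAb

end

end SemiAbelian

/-! ### The main theorem -/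

theorem mainTheorem6 {C : Type u} [Category.{v} C] [HasZeroMorphisms C] [SemiAbelian C]
    (hproj : SemiAbelian.HasEnoughRegularProjectives C) (huce : SemiAbelian.ConditionUCE C)
    (P : ObjectProperty C) (hP : SemiAbelian.IsBirkhoff P)
    (hAb : SemiAbelian.abelianObjects C ≤ P)
    {A B D : C} (f : B ⟶ A) (g : D ⟶ B)
    (hf : SemiAbelian.IsCentralExtension P f) (hg : SemiAbelian.IsCentralExtension P g) :
    SemiAbelian.IsUniversalCentralExtension P (g ≫ f) ↔
      SemiAbelian.IsUniversalCentralExtension P g := by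
  have := hg.1
  constructor
  · intro h
    have hD := h.isPerfect hP
    have hB := hD.of_epi hP g
    refine ⟨hg, fun E e he => ?_⟩
    -- Composites with `f` are known to be central only for perfect domains, so `E` is replaced by
    -- `K`.
    obtain ⟨K, i, hK, hKe⟩ := he.exists_perfect hP hB
    obtain ⟨l, hl, -⟩ := h.2 _ (huce.comp hP hAb hf hKe hB hK)
    refine ⟨l ≫ i, ?_, fun k hk => he.hom_ext hP hD ?_⟩
    · exact hf.hom_ext hP hD (by simpa using hl)
    · rw [hk]
      exact hf.hom_ext hP hD (by simpa using hl.symm)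
  · intro h
    have hD := h.isPerfect hP
    refine ⟨huce.comp hP hAb hf hg (hD.of_epi hP g) hD, fun E e he => ?_⟩
    obtain ⟨l, hl, -⟩ := h.2 _ (he.of_isPullback hP (IsPullback.of_hasPullback e f))
    have hl' : (l ≫ pullback.fst e f) ≫ e = g ≫ f := by
      rw [Category.assoc, pullback.condition, reassoc_of% hl]
    exact ⟨_, hl', fun k hk => he.hom_ext hP hD (hk.trans hl'.symm)⟩
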